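/- **Theorem.** Let $n,r\in\mathbb{N}$ and let $V_1,\dots,V_r\in\mathbb{C}^{n\times n}$ be arbitrary matrices (Lindblad terms). For $U\in\mathrm{SU}(n)$ define the real $n\times n$ matrices $$J(U)_{ij}=\sum_{k=1}^r\bigl|(U^*V_kU)_{ij}\bigr|^2,\qquad -L_U=J(U)-\operatorname{diag}\bigl(J(U)^{\top}\mathbf 1\bigr),$$ where $\mathbf 1=(1,\dots,1)$. Let $\Delta^{n-1}=\{x\in\mathbb{R}^n: x_i\ge 0,\ \sum_i x_i=1\}$. A function $x:[0,\infty)\to\Delta^{n-1}$ is called a solution of the relaxed control system if it is absolutely continuous on every compact interval $[0,T]$ and $$\dot x(t)\in\operatorname{conv}\{-L_U\,x(t): U\in\mathrm{SU}(n)\}\qquad\text{for almost every } t\ge 0 .$$ For $x,y\in\Delta^{n-1}$ we say that $x$ majorizes $y$, written $y\preceq x$, if $\sum_{i=1}^k x_i^{\downarrow}\ge\sum_{i=1}^k y_i^{\downarrow}$ for $k=1,\dots,n$, where $x_i^{\downarrow}$ denotes the $i$-th largest entry of $x$. Let $\mu:[0,\infty)\to\Delta^{n-1}$ be a solution of the relaxed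 control system and let $\lambda_0\in\Delta^{n-1}$ satisfy $\mu(0)\preceq\lambda_0$. Then there exists a solution $\lambda:[0,\infty)\to\Delta^{n-1}$ of the relaxed control system with $\lambda(0)=\lambda_0$ such that $\mu(t)\preceq\lambda(t)$ for all $t\in[0,\infty)$. -/

import Mathlib

open MeasureTheory Set

/-- The matrix `J(U)` of jump rates, `J(U)_{ij} = ∑_k |⟨i| U* V_k U |j⟩|²`. -/
noncomputable def jumpMatrix {n r : ℕ} (V : Fin r → Matrix (Fin n) (Fin n) ℂ)
    (U : Matrix (Fin n) (Fin n) ℂ) : Matrix (Fin n) (Fin n) ℝ :=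
  Matrix.of fun i j => ∑ k, ‖(U.conjTranspose * V k * U) i j‖ ^ 2

/-- The matrix `-L_U = J(U) - diag(J(U)ᵀ 𝟏)` of the induced vector field, where `𝟏` is the
all-ones vector, so that every column of `-L_U` sums to zero. -/
noncomputable def inducedGenerator {n r : ℕ} (V : Fin r → Matrix (Fin n) (Fin n) ℂ)
    (U : Matrix (Fin n) (Fin n) ℂ) : Matrix (Fin n) (Fin n) ℝ :=
  jumpMatrix V U - Matrix.diagonal ((jumpMatrix V U).transpose.mulVec fun _ => 1)

/-- The set `{-L_U x : U ∈ SU(n)}` of achievable derivatives at `x`. -/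
def achievableDerivatives {n r : ℕ} (V : Fin r → Matrix (Fin n) (Fin n) ℂ)
    (x : Fin n → ℝ) : Set (Fin n → ℝ) :=
  {v | ∃ U ∈ Matrix.specialUnitaryGroup (Fin n) ℂ, v = (inducedGenerator V U).mulVec x}

/-- `x : [0,∞) → Δ^{n-1}` is a solution of the relaxed control system: it takes values in the
standard simplex, is absolutely continuous on every interval `[0,T]`, and for almost every `t ≥ 0`
its derivative lies in the convex hull of the achievable derivatives at `x t`.
The values of `x` at negative times play no role. -/
structure IsRelaxedSolution {n r : ℕ} (V : Fin r → Matrix (Fin n) (Fin n) ℂ)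
    (x : ℝ → Fin n → ℝ) : Prop where
  mem_simplex : ∀ t, 0 ≤ t → x t ∈ stdSimplex ℝ (Fin n)
  absolutelyContinuous : ∀ T, 0 ≤ T → AbsolutelyContinuousOnInterval x 0 T
  hasDerivAt_ae : ∀ᵐ t ∂(volume.restrict (Ici (0 : ℝ))),
    ∃ v ∈ convexHull ℝ (achievableDerivatives V (x t)), HasDerivAt x v t

/-- The non-increasing rearrangement of `x`. -/
noncomputable def sortDesc {n : ℕ} (x : Fin n → ℝ) : Fin n → ℝ :=
  fun i => x (Tuple.sort x i.rev)

theorem sortDesc_antitone {n : ℕ} (x : Fin n → ℝ) : Antitone (sortDesc x) :=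
  fun _ _ h => Tuple.monotone_sort x (Fin.rev_le_rev.mpr h)

/-- `x` majorizes `y`: for each `k = 1, …, n`, the sum of the `k` largest entries of `x` is at
least that of the `k` largest entries of `y`. (It is applied to vectors of the simplex only, so the
total sums agree.) -/
def Majorizes {n : ℕ} (x y : Fin n → ℝ) : Prop :=
  ∀ k : ℕ, 1 ≤ k → k ≤ n →
    ∑ i : Fin n with i.val < k, sortDesc y i ≤ ∑ i : Fin n with i.val < k, sortDesc x i

/-! Let `Q` be the convex hull of the matrices `-L_U`. It is compact and convex, consists of
transition-rate matrices, and is stable under simultaneous permutation of rows and columns, because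
`U` may be multiplied by a permutation matrix. Only these properties (`IsGeneratorFamily`) are used.

The core is a single Euler step (`exists_step`): if `y` is majorized by `x` up to `ε` and `L ∈ Q`,
some `L' ∈ Q` makes `x + hL'x` majorize `y + hLy` up to `ε + O(h²)`. By Hahn-Banach duality it
suffices to find, for each antitone weight `c ≥ 0` separately, a relabelling of `L` that works
(`exists_perm_sum_mul_le`). There the stochastic matrix `1 + hL` is transposed onto the weights,
majorization replaces `y` by a rearrangement of `x`, and the rearrangement inequality returns to the
sorted order of `x` at a cost of `O(h²)`.

The given solution follows Euler steps up to `O(h²)`, so iteration gives polygons whose accumulated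
majorization error up to time `t` is `O(th)`. Their limit as `h → 0` is Lipschitz, solves the
inclusion because second-order chord estimates survive the limit, and majorizes the given solution
at all times. -/

/-! ### Sorted vectors, top sums and Abel's inequality. -/

/-- A permutation arranging the entries of `x` in non-increasing order. -/
noncomputable def sortPerm {n : ℕ} (x : Fin n → ℝ) : Equiv.Perm (Fin n) :=
  Fin.revPerm.trans (Tuple.sort x)

theorem sortDesc_eq_sortPerm {n : ℕ} (x : Fin n → ℝ) (i : Fin n) :
    sortDesc x i = x (sortPerm x i) := rfl

theorem sortDesc_sortPerm_symm {n : ℕ} (x : Fin n → ℝ) (i : Fin n) :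
    sortDesc x ((sortPerm x).symm i) = x i := by
  rw [sortDesc_eq_sortPerm, Equiv.apply_symm_apply]

/-- The sum of the `k` largest entries of `x`. -/
noncomputable def topSum {n : ℕ} (k : ℕ) (x : Fin n → ℝ) : ℝ :=
  ∑ i : Fin n with i.val < k, sortDesc x i

theorem sortDesc_comp_perm {n : ℕ} (x : Fin n → ℝ) (σ : Equiv.Perm (Fin n)) :
    sortDesc (x ∘ σ) = sortDesc x := by
  funext i
  exact congrFun (Tuple.comp_perm_comp_sort_eq_comp_sort (f := x) (σ := σ)) i.rev

theorem topSum_comp_perm {n : ℕ} (k : ℕ) (x : Fin n → ℝ) (σ : Equiv.Perm (Fin n)) :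
    topSum k (x ∘ σ) = topSum k x := by
  simp only [topSum, sortDesc_comp_perm]

theorem sortDesc_of_antitone {n : ℕ} {x : Fin n → ℝ} (hx : Antitone x) : sortDesc x = x := by
  have h : Monotone (x ∘ (Fin.revPerm : Equiv.Perm (Fin n))) :=
    fun a b hab => hx (Fin.rev_le_rev.mpr hab)
  have h2 := (Tuple.comp_sort_eq_comp_iff_monotone (f := x) (σ := Fin.revPerm)).mpr h
  funext i
  have := congrFun h2 i.rev
  simp only [Function.comp, Fin.revPerm_apply, Fin.rev_rev] at this
  exact this.symm

/-- The rearrangement inequality, with the second vector in arbitrary order. -/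
theorem sum_mul_perm_le_sum_mul_sortDesc {n : ℕ} {c : Fin n → ℝ} (hc : Antitone c)
    (x : Fin n → ℝ) (σ : Equiv.Perm (Fin n)) :
    ∑ i, c i * x (σ i) ≤ ∑ i, c i * sortDesc x i := by
  have h : Monovary c (sortDesc x) := hc.monovary (sortDesc_antitone x)
  have := h.sum_mul_comp_perm_le_sum_mul (σ := σ.trans (sortPerm x).symm)
  simpa only [Equiv.trans_apply, sortDesc_sortPerm_symm] using this

theorem sum_mul_le_sum_sortDesc_mul_sortDesc {n : ℕ} (d x : Fin n → ℝ) :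
    ∑ i, d i * x i ≤ ∑ i, sortDesc d i * sortDesc x i := by
  have := sum_mul_perm_le_sum_mul_sortDesc (sortDesc_antitone d) x (sortPerm d)
  rw [← Equiv.sum_comp (sortPerm d) (fun i => d i * x i)]
  exact this

theorem sum_perm_le_topSum {n : ℕ} (k : ℕ) (x : Fin n → ℝ) (σ : Equiv.Perm (Fin n)) :
    ∑ i : Fin n with i.val < k, x (σ i) ≤ topSum k x := by
  have hc : Antitone (fun i : Fin n => if i.val < k then (1 : ℝ) else 0) := by
    intro a b hab
    have : a.val ≤ b.val := hab
    dsimp only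
    split_ifs <;> grind
  have := sum_mul_perm_le_sum_mul_sortDesc hc x σ
  simpa only [topSum, Finset.sum_filter, ite_mul, one_mul, zero_mul] using this

theorem topSum_le_add {n : ℕ} (k : ℕ) {x y : Fin n → ℝ} {δ : ℝ} (hδ : 0 ≤ δ)
    (h : ∀ i, x i ≤ y i + δ) : topSum k x ≤ topSum k y + n * δ := by
  have h1 : topSum k x ≤ ∑ i : Fin n with i.val < k, (y (sortPerm x i) + δ) :=
    Finset.sum_le_sum fun i _ => h _
  have h2 : ∑ i : Fin n with i.val < k, δ ≤ n * δ := by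
    rw [Finset.sum_const, nsmul_eq_mul]
    refine mul_le_mul_of_nonneg_right ?_ hδ
    have := Finset.card_filter_le (Finset.univ : Finset (Fin n)) (fun i => i.val < k)
    rw [Finset.card_univ, Fintype.card_fin] at this
    exact_mod_cast this
  have h3 := sum_perm_le_topSum k y (sortPerm x)
  rw [Finset.sum_add_distrib] at h1
  linarith

theorem continuous_topSum {n : ℕ} (k : ℕ) : Continuous (topSum (n := n) k) := by
  have key : ∀ x y : Fin n → ℝ, topSum k x ≤ topSum k y + n * dist x y := fun x y =>
    topSum_le_add k dist_nonneg fun i => by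
      have := dist_le_pi_dist x y i
      rw [Real.dist_eq] at this
      linarith [le_abs_self (x i - y i)]
  refine (LipschitzWith.of_le_add_mul' (n : ℝ) key).continuous

/-- Pigeonhole: the positions of the `i + 1` largest entries of `x` cannot all be among those of the
`i` largest entries of `y`. -/
theorem sortDesc_le_add {n : ℕ} {x y : Fin n → ℝ} {δ : ℝ} (h : ∀ i, x i ≤ y i + δ) (i : Fin n) :
    sortDesc x i ≤ sortDesc y i + δ := by
  obtain ⟨j, hj, hj'⟩ : ∃ j ∈ (Finset.Iic i).image (sortPerm x),
      j ∉ (Finset.Iio i).image (sortPerm y) := by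
    apply Finset.exists_mem_notMem_of_card_lt_card
    rw [Finset.card_image_of_injective _ (sortPerm x).injective,
      Finset.card_image_of_injective _ (sortPerm y).injective, Fin.card_Iic, Fin.card_Iio]
    omega
  obtain ⟨a, ha, rfl⟩ := Finset.mem_image.mp hj
  have h1 : sortDesc x i ≤ x (sortPerm x a) := sortDesc_antitone x (Finset.mem_Iic.mp ha)
  have h2 : y (sortPerm x a) ≤ sortDesc y i := by
    rw [← sortDesc_sortPerm_symm y (sortPerm x a)]
    apply sortDesc_antitone
    by_contra hlt
    exact hj' (Finset.mem_image.mpr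
      ⟨_, Finset.mem_Iio.mpr (not_le.mp hlt), Equiv.apply_symm_apply _ _⟩)
  linarith [h (sortPerm x a)]

theorem abs_sortDesc_sub_le {n : ℕ} {x y : Fin n → ℝ} {δ : ℝ} (h : ∀ i, |x i - y i| ≤ δ)
    (i : Fin n) : |sortDesc x i - sortDesc y i| ≤ δ := by
  have h1 := sortDesc_le_add (x := x) (y := y) (δ := δ)
    (fun j => by linarith [(abs_le.mp (h j)).2]) i
  have h2 := sortDesc_le_add (x := y) (y := x) (δ := δ)
    (fun j => by linarith [(abs_le.mp (h j)).1]) i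
  rw [abs_le]; constructor <;> linarith

/-- Summation by parts as an induction: lowering the last weight from `d m` to `d (m + 1)` costs at
most `ε * (d m - d (m + 1))`, and these costs telescope. -/
theorem sum_range_succ_mul_le_of_antitone {d g : ℕ → ℝ} {ε : ℝ} {N : ℕ}
    (hd : ∀ m < N, d (m + 1) ≤ d m)
    (hg : ∀ m ≤ N, ∑ i ∈ Finset.range (m + 1), g i ≤ ε) :
    ∀ m ≤ N, ∑ i ∈ Finset.range (m + 1), d i * g i ≤
      d m * ∑ i ∈ Finset.range (m + 1), g i + ε * (d 0 - d m) := by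
  intro m
  induction m with
  | zero => intro _; simp
  | succ m ih =>
    intro hm
    have h1 := ih (by omega)
    have h2 := hd m (by omega)
    have h3 := mul_le_mul_of_nonneg_left (hg m (by omega)) (sub_nonneg.mpr h2)
    rw [Finset.sum_range_succ, Finset.sum_range_succ (fun i => g i)]
    linarith

/-- Abel's inequality: partial sums bounded by `ε` and antitone weights in `[0, W]`. -/
theorem sum_mul_le_of_partialSum_le {n : ℕ} {d g : Fin n → ℝ} {ε W : ℝ} (hd : Antitone d)
    (hd0 : ∀ i, 0 ≤ d i) (hdW : ∀ i, d i ≤ W) (hε : 0 ≤ ε) (hW : 0 ≤ W)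
    (hg : ∀ k ≤ n, ∑ i : Fin n with i.val < k, g i ≤ ε) : ∑ i, d i * g i ≤ ε * W := by
  rcases n with _ | N
  · simpa using mul_nonneg hε hW
  let d' : ℕ → ℝ := fun i => if h : i < N + 1 then d ⟨i, h⟩ else 0
  let g' : ℕ → ℝ := fun i => if h : i < N + 1 then g ⟨i, h⟩ else 0
  have e1 : ∀ i : Fin (N + 1), d' i = d i := fun i => dif_pos i.isLt
  have e2 : ∀ i : Fin (N + 1), g' i = g i := fun i => dif_pos i.isLt
  have hpart : ∀ m ≤ N, ∑ i ∈ Finset.range (m + 1), g' i =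
      ∑ i : Fin (N + 1) with i.val < m + 1, g i := by
    intro m hm
    have : Finset.range (m + 1) = (Finset.range (N + 1)).filter (· < m + 1) := by
      ext a; simp only [Finset.mem_range, Finset.mem_filter]; omega
    rw [this, Finset.sum_filter, Finset.sum_filter,
      ← Fin.sum_univ_eq_sum_range (fun i => if i < m + 1 then g' i else 0)]
    simp only [e2]
  have hanti : ∀ m < N, d' (m + 1) ≤ d' m := by
    intro m hm
    have := hd (show (⟨m, by omega⟩ : Fin (N + 1)) ≤ ⟨m + 1, by omega⟩ by simp)
    simpa only [d', dif_pos (show m < N + 1 by omega), dif_pos (show m + 1 < N + 1 by omega)] using this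
  have hgg : ∀ m ≤ N, ∑ i ∈ Finset.range (m + 1), g' i ≤ ε := by
    intro m hm; rw [hpart m hm]; exact hg _ (by omega)
  have key := sum_range_succ_mul_le_of_antitone hanti hgg N le_rfl
  rw [← Fin.sum_univ_eq_sum_range (fun i => d' i * g' i)] at key
  simp only [e1, e2] at key
  have a1 : 0 ≤ d' N := by
    have := e1 (Fin.last N); rw [Fin.val_last] at this; rw [this]; exact hd0 _
  have a2 : d' 0 ≤ W := by
    have := e1 0; rw [Fin.val_zero] at this; rw [this]; exact hdW _
  have a3 := mul_le_mul_of_nonneg_left (hgg N le_rfl) a1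
  nlinarith [mul_le_mul_of_nonneg_left a2 hε]

/-! ### One Euler step against a single weight vector. -/

/-- A compact convex family of transition-rate matrices, invariant under relabelling of the states,
with entries bounded by `K`. -/
structure IsGeneratorFamily {n : ℕ} (Q : Set (Matrix (Fin n) (Fin n) ℝ)) (K : ℝ) : Prop where
  convex : Convex ℝ Q
  isCompact : IsCompact Q
  submatrix_mem : ∀ L ∈ Q, ∀ π : Equiv.Perm (Fin n), L.submatrix π π ∈ Q
  offDiag_nonneg : ∀ L ∈ Q, ∀ i j, i ≠ j → 0 ≤ L i j
  sum_col : ∀ L ∈ Q, ∀ j, ∑ i, L i j = 0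
  abs_le : ∀ L ∈ Q, ∀ i j, |L i j| ≤ K
  pos : 0 < K

theorem abs_mulVec_le {n : ℕ} {L : Matrix (Fin n) (Fin n) ℝ} {K : ℝ} (hL : ∀ i j, |L i j| ≤ K)
    (x : Fin n → ℝ) (i : Fin n) : |L.mulVec x i| ≤ K * ∑ j, |x j| := by
  rw [Matrix.mulVec, dotProduct, Finset.mul_sum]
  refine (Finset.abs_sum_le_sum_abs _ _).trans (Finset.sum_le_sum fun j _ => ?_)
  rw [abs_mul]
  exact mul_le_mul_of_nonneg_right (hL i j) (abs_nonneg _)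

theorem abs_mulVec_le_of_forall_le {n : ℕ} {L : Matrix (Fin n) (Fin n) ℝ} {K δ : ℝ}
    (hL : ∀ i j, |L i j| ≤ K) (hK : 0 ≤ K) {x : Fin n → ℝ} (hx : ∀ j, |x j| ≤ δ) (i : Fin n) :
    |L.mulVec x i| ≤ n * K * δ := by
  refine (abs_mulVec_le hL x i).trans ?_
  have : ∑ j, |x j| ≤ n * δ := by
    refine (Finset.sum_le_sum fun j _ => hx j).trans ?_
    simp
  calc K * ∑ j, |x j| ≤ K * (n * δ) := mul_le_mul_of_nonneg_left this hK
    _ = _ := by ring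

theorem abs_mulVec_le_of_mem_stdSimplex {n : ℕ} {L : Matrix (Fin n) (Fin n) ℝ} {K : ℝ}
    (hL : ∀ i j, |L i j| ≤ K) {x : Fin n → ℝ} (hx : x ∈ stdSimplex ℝ (Fin n)) (i : Fin n) :
    |L.mulVec x i| ≤ K := by
  have h := abs_mulVec_le hL x i
  rwa [Finset.sum_congr rfl fun j _ => abs_of_nonneg (hx.1 j), hx.2, mul_one] at h

theorem stdSimplex_comp_perm {n : ℕ} {x : Fin n → ℝ} (hx : x ∈ stdSimplex ℝ (Fin n))
    (σ : Equiv.Perm (Fin n)) : x ∘ σ ∈ stdSimplex ℝ (Fin n) :=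
  ⟨fun _ => hx.1 _, (Equiv.sum_comp σ x).trans hx.2⟩

theorem submatrix_mulVec_perm {n : ℕ} (L : Matrix (Fin n) (Fin n) ℝ) (π : Equiv.Perm (Fin n))
    (x : Fin n → ℝ) (i : Fin n) :
    (L.submatrix π π).mulVec x i = L.mulVec (x ∘ π.symm) (π i) := by
  simp only [Matrix.mulVec, dotProduct, Matrix.submatrix_apply]
  rw [← Equiv.sum_comp π (fun j => L (π i) j * (x ∘ π.symm) j)]
  simp

namespace IsGeneratorFamily

variable {n : ℕ} {Q : Set (Matrix (Fin n) (Fin n) ℝ)} {K : ℝ}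

/-- The condition `h * K ≤ 1` keeps the diagonal nonnegative; with the column sums below, `1 + h •
L` is column-stochastic. -/
theorem one_add_smul_nonneg (hQ : IsGeneratorFamily Q K) {L : Matrix (Fin n) (Fin n) ℝ}
    (hL : L ∈ Q) {h : ℝ} (hh : 0 ≤ h) (hhK : h * K ≤ 1) (i j : Fin n) :
    0 ≤ (1 + h • L) i j := by
  rw [Matrix.add_apply, Matrix.smul_apply, smul_eq_mul]
  by_cases hij : i = j
  · subst hij
    rw [Matrix.one_apply_eq]
    have := mul_le_mul_of_nonneg_left (abs_le'.mp (hQ.abs_le L hL i i)).2 hh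
    linarith
  · rw [Matrix.one_apply_ne hij, zero_add]
    exact mul_nonneg hh (hQ.offDiag_nonneg L hL i j hij)

theorem one_add_smul_sum_col (hQ : IsGeneratorFamily Q K) {L : Matrix (Fin n) (Fin n) ℝ}
    (hL : L ∈ Q) (h : ℝ) (j : Fin n) : ∑ i, (1 + h • L) i j = 1 := by
  simp only [Matrix.add_apply, Matrix.smul_apply, smul_eq_mul, Finset.sum_add_distrib,
    ← Finset.mul_sum, hQ.sum_col L hL j, Matrix.one_apply]
  simp

theorem one_add_smul_mulVec (L : Matrix (Fin n) (Fin n) ℝ) (h : ℝ) (x : Fin n → ℝ) :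
    (1 + h • L).mulVec x = x + h • L.mulVec x := by
  rw [Matrix.add_mulVec, Matrix.one_mulVec, Matrix.smul_mulVec]

theorem euler_mem_stdSimplex (hQ : IsGeneratorFamily Q K) {L : Matrix (Fin n) (Fin n) ℝ}
    (hL : L ∈ Q) {h : ℝ} (hh : 0 ≤ h) (hhK : h * K ≤ 1) {x : Fin n → ℝ}
    (hx : x ∈ stdSimplex ℝ (Fin n)) : x + h • L.mulVec x ∈ stdSimplex ℝ (Fin n) := by
  rw [← one_add_smul_mulVec]
  constructor
  · intro i
    exact dotProduct_nonneg_of_nonneg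
      (hQ.one_add_smul_nonneg hL hh hhK i) hx.1
  simp only [Matrix.mulVec, dotProduct]
  rw [Finset.sum_comm]
  simp only [← Finset.sum_mul, hQ.one_add_smul_sum_col hL, one_mul]
  exact hx.2

/-- One Euler step tested against a single antitone weight `c`: relabelling the states lets the
step from the larger vector dominate the step from the smaller one, up to second order in `h`. -/
theorem exists_perm_sum_mul_le (hQ : IsGeneratorFamily Q K) {L : Matrix (Fin n) (Fin n) ℝ}
    (hL : L ∈ Q) {h : ℝ} (hh : 0 ≤ h) (hhK : h * K ≤ 1) {x y : Fin n → ℝ}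
    (hx : x ∈ stdSimplex ℝ (Fin n)) {ε : ℝ} (hε : 0 ≤ ε)
    (hmaj : ∀ k ≤ n, topSum k y ≤ topSum k x + ε)
    {c : Fin n → ℝ} {W : ℝ} (hc : Antitone c) (hc0 : ∀ i, 0 ≤ c i) (hcW : ∀ i, c i ≤ W)
    (hW : 0 ≤ W) :
    ∃ π : Equiv.Perm (Fin n),
      ∑ i, c i * sortDesc (y + h • L.mulVec y) i ≤
        ∑ i, c i * (sortDesc x + h • (L.submatrix π π).mulVec (sortDesc x)) i +
          (ε + 2 * n ^ 2 * K ^ 2 * h ^ 2) * W := by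
  set Φ : Matrix (Fin n) (Fin n) ℝ := 1 + h • L with hΦ
  set ℓ := sortDesc x with hℓ
  have hℓS : ℓ ∈ stdSimplex ℝ (Fin n) := stdSimplex_comp_perm hx (sortPerm x)
  have hℓA : Antitone ℓ := sortDesc_antitone x
  rw [← one_add_smul_mulVec]
  set σ := sortPerm (Φ.mulVec y)
  -- The weights after transposing `Φ` onto them. Unit column sums keep them in `[0, W]`, as Abel's
  -- inequality requires.
  set d : Fin n → ℝ := Matrix.vecMul (c ∘ σ.symm) Φ with hd
  have hdj : ∀ j, d j = ∑ i, c (σ.symm i) * Φ i j := fun j => rfl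
  have hd0 : ∀ j, 0 ≤ d j := fun j => (hdj j).symm ▸ Finset.sum_nonneg fun i _ =>
    mul_nonneg (hc0 _) (hQ.one_add_smul_nonneg hL hh hhK i j)
  have hdW : ∀ j, d j ≤ W := fun j => by
    rw [hdj]
    calc ∑ i, c (σ.symm i) * Φ i j ≤ ∑ i, W * Φ i j := Finset.sum_le_sum fun i _ =>
          mul_le_mul_of_nonneg_right (hcW _) (hQ.one_add_smul_nonneg hL hh hhK i j)
      _ = W := by rw [← Finset.mul_sum, hQ.one_add_smul_sum_col hL, mul_one]
  have hdot : ∀ z : Fin n → ℝ, ∑ i, c (σ.symm i) * Φ.mulVec z i = ∑ j, d j * z j := fun z =>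
    Matrix.dotProduct_mulVec (c ∘ σ.symm) Φ z
  have s1 : ∑ i, c i * sortDesc (Φ.mulVec y) i = ∑ j, d j * y j := by
    rw [← hdot, ← Equiv.sum_comp σ (fun i => c (σ.symm i) * Φ.mulVec y i)]
    simp only [Equiv.symm_apply_apply]
    rfl
  have s2 : ∑ j, d j * y j ≤ ∑ i, sortDesc d i * ℓ i + ε * W := by
    refine (sum_mul_le_sum_sortDesc_mul_sortDesc d y).trans ?_
    have := sum_mul_le_of_partialSum_le (d := sortDesc d) (g := sortDesc y - ℓ) (ε := ε) (W := W)
      (sortDesc_antitone d) (fun _ => hd0 _) (fun _ => hdW _) hε hW (fun k hk => by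
        have := hmaj k hk
        simp only [topSum] at this
        simp only [Pi.sub_apply, Finset.sum_sub_distrib]
        linarith)
    simp only [Pi.sub_apply, mul_sub, Finset.sum_sub_distrib] at this
    linarith
  set ρ := sortPerm d
  -- The entries of `x` placed in the order of `d`, the worst case allowed by majorization.
  set z : Fin n → ℝ := ℓ ∘ ρ.symm with hz
  have hzS : z ∈ stdSimplex ℝ (Fin n) := stdSimplex_comp_perm hℓS ρ.symm
  have s3 : ∑ i, sortDesc d i * ℓ i = ∑ i, c (σ.symm i) * Φ.mulVec z i := by
    rw [hdot, ← Equiv.sum_comp ρ (fun j => d j * z j)]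
    simp only [hz, Function.comp, Equiv.symm_apply_apply]
    rfl
  set π := sortPerm (Φ.mulVec z) with hπ
  have s4 : ∑ i, c (σ.symm i) * Φ.mulVec z i ≤ ∑ i, c i * Φ.mulVec z (π i) := by
    have := sum_mul_perm_le_sum_mul_sortDesc hc (Φ.mulVec z) σ
    rw [← Equiv.sum_comp σ (fun i => c (σ.symm i) * Φ.mulVec z i)]
    simp only [Equiv.symm_apply_apply]
    exact this
  have hsz : sortDesc z = ℓ := by
    rw [hz, sortDesc_comp_perm, sortDesc_of_antitone hℓA]
  -- One `h * K` bounds the move from `z` to `Φ z`, the other the induced move of the sorted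
  -- vectors; `π` sorts `Φ z`, not `z`.
  have hclose : ∀ j, |z j - ℓ (π.symm j)| ≤ 2 * (h * K) := by
    have h1 : ∀ j, |Φ.mulVec z j - z j| ≤ h * K := fun j => by
      rw [hΦ, one_add_smul_mulVec]
      simp only [Pi.add_apply, add_sub_cancel_left, Pi.smul_apply, smul_eq_mul, abs_mul,
        abs_of_nonneg hh]
      exact mul_le_mul_of_nonneg_left (abs_mulVec_le_of_mem_stdSimplex (hQ.abs_le L hL) hzS j) hh
    intro j
    have h2 := abs_sortDesc_sub_le h1 (π.symm j)
    rw [hsz, hπ, sortDesc_sortPerm_symm, ← hπ] at h2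
    have h3 := h1 j
    rw [_root_.abs_le] at h2 h3 ⊢
    constructor <;> linarith [h2.1, h2.2, h3.1, h3.2]
  refine ⟨π, ?_⟩
  have s5 : ∀ i, Φ.mulVec z (π i) - (ℓ + h • (L.submatrix π π).mulVec ℓ) i =
      (z (π i) - ℓ i) + h * L.mulVec (z - ℓ ∘ π.symm) (π i) := fun i => by
    rw [hΦ, one_add_smul_mulVec, Matrix.mulVec_sub]
    simp only [Pi.add_apply, Pi.smul_apply, smul_eq_mul, submatrix_mulVec_perm, Pi.sub_apply]
    ring
  -- The difference between `z ∘ π` and `ℓ` is only `O(h)`, but tested against `c` it has a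
  -- favourable sign. The remaining error is `h * L` applied to an `O(h)` vector, hence of second
  -- order.
  have s6 : ∑ i, c i * z (π i) ≤ ∑ i, c i * ℓ i := by
    have := sum_mul_perm_le_sum_mul_sortDesc hc z π
    rwa [hsz] at this
  have s7 : ∀ i, c i * (h * L.mulVec (z - ℓ ∘ π.symm) (π i)) ≤
      W * (h * (n * K * (2 * (h * K)))) := fun i => by
    have h1 := abs_mulVec_le_of_forall_le (hQ.abs_le L hL) hQ.pos.le
      (x := z - ℓ ∘ π.symm) hclose (π i)
    have hKp := hQ.pos.le
    refine (mul_le_mul_of_nonneg_left (mul_le_mul_of_nonneg_left ((le_abs_self _).trans h1) hh)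
      (hc0 i)).trans ?_
    exact mul_le_mul_of_nonneg_right (hcW i) (by positivity)
  have s8 : ∑ i, c i * (Φ.mulVec z (π i) - (ℓ + h • (L.submatrix π π).mulVec ℓ) i) ≤
      n * (W * (h * (n * K * (2 * (h * K))))) := by
    simp only [s5, mul_add, mul_sub, Finset.sum_add_distrib, Finset.sum_sub_distrib]
    have := Finset.sum_le_sum fun i (_ : i ∈ Finset.univ) => s7 i
    rw [Finset.sum_const, Finset.card_univ, Fintype.card_fin, nsmul_eq_mul] at this
    linarith
  simp only [mul_sub, Finset.sum_sub_distrib] at s8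
  linarith

end IsGeneratorFamily

/-! ### Duality: from single weights to full majorization. -/

/-- If every nonnegative combination of the coordinates of `b` is dominated by that of some `a i`,
then `b` lies below a convex combination of the `a i`. -/
theorem exists_stdSimplex_le_sum {ι κ : Type*} [Fintype ι] [Fintype κ] (a : ι → κ → ℝ) (b : κ → ℝ)
    (h : ∀ w : κ → ℝ, (∀ k, 0 ≤ w k) → ∃ i, ∑ k, w k * b k ≤ ∑ k, w k * a i k) :
    ∃ p ∈ stdSimplex ℝ ι, ∀ k, b k ≤ ∑ i, p i * a i k := by
  classical
  by_cases hd : Disjoint (Fintype.linearCombination ℝ a '' stdSimplex ℝ ι) (Ici b)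
  · exfalso
    obtain ⟨f, u, v, hu, huv, hv⟩ := geometric_hahn_banach_compact_closed 
      ((convex_stdSimplex ℝ ι).linear_image _)
      ((isCompact_stdSimplex ℝ ι).image (LinearMap.continuous_on_pi _)) (convex_Ici b) isClosed_Ici hd
    have hf : ∀ z : κ → ℝ, f z = ∑ k, f (Pi.single k 1) * z k := fun z => by
      conv_lhs => rw [← Finset.univ_sum_single z]
      rw [map_sum]
      refine Finset.sum_congr rfl fun k _ => ?_
      rw [← mul_one (z k), ← smul_eq_mul, Pi.single_smul, map_smul, smul_eq_mul, smul_eq_mul]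
      ring
    have hpos : ∀ k, 0 ≤ f (Pi.single k 1) := fun k => by
      by_contra hneg
      push Not at hneg
      have hb := hv b self_mem_Ici
      -- Chosen so that `f (b + t • Pi.single k 1) = v`, contradicting strict separation.
      set t := (f b - v) / (-f (Pi.single k 1)) with ht
      have ht0 : 0 ≤ t := div_nonneg (by linarith) (by linarith)
      have := hv (b + t • Pi.single k 1) (by
        intro j
        simp only [Pi.add_apply, Pi.smul_apply, smul_eq_mul, le_add_iff_nonneg_right]
        refine mul_nonneg ht0 ?_
        by_cases hj : j = k
        · subst hj; simp
        · simp [hj])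
      rw [map_add, map_smul, smul_eq_mul, ht, div_mul_eq_mul_div, div_neg,
        mul_div_cancel_right₀ _ hneg.ne] at this
      linarith
    obtain ⟨i, hi⟩ := h _ hpos
    rw [← hf, ← hf] at hi
    linarith [hu (a i) ⟨Pi.single i 1, single_mem_stdSimplex ℝ i, by simp⟩, hv b self_mem_Ici]
  · obtain ⟨z, hz, hbz⟩ := Set.not_disjoint_iff.mp hd
    obtain ⟨p, hp, rfl⟩ := hz
    refine ⟨p, hp, fun k => (hbz k).trans_eq ?_⟩
    simp [Fintype.linearCombination_apply]

namespace IsGeneratorFamily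

variable {n : ℕ} {Q : Set (Matrix (Fin n) (Fin n) ℝ)} {K : ℝ}

/-- One Euler step preserves approximate majorization up to an error of second order. -/
theorem exists_step (hQ : IsGeneratorFamily Q K) {L : Matrix (Fin n) (Fin n) ℝ}
    (hL : L ∈ Q) {h : ℝ} (hh : 0 ≤ h) (hhK : h * K ≤ 1) {x y : Fin n → ℝ}
    (hx : x ∈ stdSimplex ℝ (Fin n)) {ε : ℝ} (hε : 0 ≤ ε)
    (hmaj : ∀ k ≤ n, topSum k y ≤ topSum k x + ε) :
    ∃ L' ∈ Q, ∀ k ≤ n, topSum k (y + h • L.mulVec y) ≤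
      topSum k (x + h • L'.mulVec x) + (ε + 2 * n ^ 2 * K ^ 2 * h ^ 2) := by
  set ℓ := sortDesc x with hℓ
  set δ := ε + 2 * n ^ 2 * K ^ 2 * h ^ 2 with hδ
  let a : Equiv.Perm (Fin n) → Fin (n + 1) → ℝ := fun π k =>
    ∑ i : Fin n with i.val < k.val, (ℓ + h • (L.submatrix π π).mulVec ℓ) i
  let b : Fin (n + 1) → ℝ := fun k => topSum k.val (y + h • L.mulVec y) - δ
  obtain ⟨p, hp, hpb⟩ := exists_stdSimplex_le_sum a b fun w hw => by
    -- Weighting the top sums by `w ≥ 0` amounts to weighting the sorted entries by the tail sums of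
    -- `w`, which are antitone.
    set c : Fin n → ℝ := fun i => ∑ k : Fin (n + 1) with i.val < k.val, w k with hc
    have hsum : ∀ g : Fin n → ℝ,
        ∑ k : Fin (n + 1), w k * ∑ i : Fin n with i.val < k.val, g i = ∑ i, c i * g i := by
      intro g
      simp only [hc, Finset.sum_filter, Finset.mul_sum, Finset.sum_mul]
      rw [Finset.sum_comm]
      refine Finset.sum_congr rfl fun i _ => Finset.sum_congr rfl fun k _ => ?_
      split_ifs <;> simp
    have hcA : Antitone c := fun i j hij =>
      Finset.sum_le_sum_of_subset_of_nonneg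
        (fun k hk => by
          have h1 : i.val ≤ j.val := hij
          simp only [Finset.mem_filter, Finset.mem_univ, true_and] at hk ⊢
          omega) fun k _ _ => hw k
    obtain ⟨π, hπ⟩ := hQ.exists_perm_sum_mul_le hL hh hhK hx hε hmaj hcA
      (fun i => Finset.sum_nonneg fun k _ => hw k)
      (fun i => Finset.sum_le_sum_of_subset_of_nonneg (Finset.filter_subset _ _)
        fun k _ _ => hw k) (Finset.sum_nonneg fun k _ => hw k)
    refine ⟨π, ?_⟩
    simp only [a, b, mul_sub, Finset.sum_sub_distrib, ← Finset.sum_mul, hsum, topSum]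
    linarith
  set L'' : Matrix (Fin n) (Fin n) ℝ := ∑ π, p π • L.submatrix π π with hL''
  have hL''Q : L'' ∈ Q :=
    hQ.convex.sum_mem (fun π _ => hp.1 π) hp.2 fun π _ => hQ.submatrix_mem L hL π
  set s := sortPerm x with hs
  -- `L''` acts on the sorted vector `ℓ`; conjugating by the sorting permutation makes it act on
  -- `x`.
  refine ⟨L''.submatrix s.symm s.symm, hQ.submatrix_mem _ hL''Q _, fun k hk => ?_⟩
  have e1 : x + h • (L''.submatrix s.symm s.symm).mulVec x = (ℓ + h • L''.mulVec ℓ) ∘ s.symm := by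
    funext i
    simp only [Pi.add_apply, Pi.smul_apply, Function.comp, submatrix_mulVec_perm, smul_eq_mul,
      Equiv.symm_symm]
    have hxi : ℓ (s.symm i) = x i := sortDesc_sortPerm_symm x i
    rw [hxi]
    rfl
  have e2 : ∑ π, p π * a π ⟨k, by omega⟩ =
      ∑ i : Fin n with i.val < k, (ℓ + h • L''.mulVec ℓ) i := by
    simp only [a, Finset.mul_sum]
    rw [Finset.sum_comm]
    refine Finset.sum_congr rfl fun i _ => ?_
    simp only [hL'', Matrix.sum_mulVec, Matrix.smul_mulVec, Pi.add_apply, Pi.smul_apply,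
      smul_eq_mul, Finset.sum_apply, mul_add, Finset.sum_add_distrib, ← Finset.sum_mul, hp.2,
      one_mul, Finset.mul_sum]
    congr 1
    exact Finset.sum_congr rfl fun π _ => by ring
  have h1 := hpb ⟨k, by omega⟩
  rw [e2] at h1
  -- The step may destroy the order of `ℓ`, but the first `k` entries never exceed the top sum,
  -- which is the direction needed.
  have h2 := sum_perm_le_topSum k (ℓ + h • L''.mulVec ℓ) 1
  rw [e1, topSum_comp_perm]
  simp only [b] at h1
  simp only [Equiv.Perm.coe_one, id] at h2
  linarith

end IsGeneratorFamily

/-! ### The hull of the induced generators is a generator family. -/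

/-- In a finite-dimensional space the convex hull of a compact set is compact. -/
theorem isCompact_convexHull_of_isCompact {E : Type*} [AddCommGroup E] [Module ℝ E]
    [FiniteDimensional ℝ E] [TopologicalSpace E] [IsTopologicalAddGroup E] [ContinuousSMul ℝ E]
    {s : Set E} (hs : IsCompact s) : IsCompact (convexHull ℝ s) := by
  rcases s.eq_empty_or_nonempty with rfl | ⟨e, he⟩
  · simp
  let ι := Fin (Module.finrank ℝ E + 1)
  have hcpt : IsCompact (stdSimplex ℝ ι ×ˢ (univ.pi fun _ : ι => s)) :=
    (isCompact_stdSimplex ℝ ι).prod (isCompact_univ_pi fun _ => hs)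
  have hcont : Continuous fun q : (ι → ℝ) × (ι → E) => ∑ i, q.1 i • q.2 i := by fun_prop
  convert hcpt.image hcont
  ext x
  constructor
  · intro hx
    obtain ⟨κ, _, z, w, hz, hind, hw, hw1, rfl⟩ := eq_pos_convex_span_of_mem_convexHull hx
    have hcard : Fintype.card κ ≤ Fintype.card ι := by
      rw [Fintype.card_fin]
      exact hind.card_le_finrank_succ.trans
        (Nat.succ_le_succ (Submodule.finrank_le _))
    obtain ⟨f⟩ := Function.Embedding.nonempty_of_card_le hcard
    -- Carathéodory representations may use fewer points; they are padded with weight zero at the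
    -- point `e`.
    refine ⟨(Function.extend f w 0, Function.extend f z fun _ => e), ⟨⟨?_, ?_⟩, ?_⟩, ?_⟩
    · intro i
      by_cases hi : ∃ a, f a = i
      · obtain ⟨a, rfl⟩ := hi
        simp only [f.injective.extend_apply]
        exact (hw a).le
      · simp only [Function.extend_apply' _ _ _ hi]
        exact le_rfl
    · rw [← hw1]
      symm
      refine Fintype.sum_of_injective f f.injective _ _ (fun i hi => ?_) fun a => ?_
      · exact Function.extend_apply' _ _ _ hi
      · exact (f.injective.extend_apply _ _ _).symm
    · intro i _
      by_cases hi : ∃ a, f a = i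
      · obtain ⟨a, rfl⟩ := hi
        simp only [f.injective.extend_apply]
        exact hz (mem_range_self a)
      · simp only [Function.extend_apply' _ _ _ hi]
        exact he
    · symm
      refine Fintype.sum_of_injective f f.injective _ _ (fun i hi => ?_) fun a => ?_
      · simp only [Function.extend_apply' _ _ _ hi, Pi.zero_apply, zero_smul]
      · simp only [f.injective.extend_apply]
  · rintro ⟨⟨w, z⟩, ⟨hw, hz⟩, rfl⟩
    exact (convex_convexHull ℝ s).sum_mem (fun i _ => hw.1 i) hw.2
      fun i _ => subset_convexHull ℝ s (hz i (mem_univ i))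

theorem isCompact_specialUnitaryGroup (n : ℕ) :
    IsCompact (Matrix.specialUnitaryGroup (Fin n) ℂ : Set (Matrix (Fin n) (Fin n) ℂ)) := by
  have hbig : IsCompact (univ.pi fun _ : Fin n => univ.pi fun _ : Fin n =>
      Metric.closedBall (0 : ℂ) 1) :=
    isCompact_univ_pi fun _ => isCompact_univ_pi fun _ => isCompact_closedBall 0 1
  refine IsCompact.of_isClosed_subset (hbig : IsCompact (X := Matrix (Fin n) (Fin n) ℂ) _) ?_ ?_
  · have : (Matrix.specialUnitaryGroup (Fin n) ℂ : Set (Matrix (Fin n) (Fin n) ℂ)) =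
        {U | U * star U = 1} ∩ {U | U.det = 1} := by
      ext U
      simp only [SetLike.mem_coe, Matrix.mem_specialUnitaryGroup_iff, Matrix.mem_unitaryGroup_iff]
      rfl
    rw [this]
    exact (isClosed_eq (by fun_prop) continuous_const).inter
      (isClosed_eq (Continuous.matrix_det continuous_id) continuous_const)
  · intro U hU i _ j _
    rw [mem_closedBall_zero_iff]
    exact entry_norm_bound_of_unitary (Matrix.mem_specialUnitaryGroup_iff.mp hU).1 i j

section Generators

variable {n r : ℕ} (V : Fin r → Matrix (Fin n) (Fin n) ℂ)

/-- The convex hull of the induced generators. -/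
def generatorHull : Set (Matrix (Fin n) (Fin n) ℝ) :=
  convexHull ℝ (inducedGenerator V '' (Matrix.specialUnitaryGroup (Fin n) ℂ : Set _))

/-- Since `L ↦ L x` is linear, one convex set of matrices serves all states `x` at once. -/
theorem convexHull_achievableDerivatives (x : Fin n → ℝ) :
    convexHull ℝ (achievableDerivatives V x) = (fun L => L.mulVec x) '' generatorHull V := by
  have h := LinearMap.image_convexHull (LinearMap.flip (Matrix.mulVecBilin ℝ ℝ) x :
    Matrix (Fin n) (Fin n) ℝ →ₗ[ℝ] (Fin n → ℝ))
    (inducedGenerator V '' (Matrix.specialUnitaryGroup (Fin n) ℂ : Set _))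
  rw [image_image] at h
  refine Eq.trans ?_ h.symm
  congr 1
  ext v
  constructor
  · rintro ⟨U, hU, rfl⟩; exact ⟨U, hU, rfl⟩
  · rintro ⟨U, hU, rfl⟩; exact ⟨U, hU, rfl⟩

theorem continuous_inducedGenerator : Continuous (inducedGenerator V) := by
  have h1 : Continuous (jumpMatrix V) := by
    refine continuous_matrix fun i j => ?_
    simp only [jumpMatrix, Matrix.of_apply]
    refine continuous_finsetSum _ fun k _ => ?_
    have : Continuous fun U : Matrix (Fin n) (Fin n) ℂ => U.conjTranspose * V k * U := by fun_prop
    exact (this.matrix_elem i j).norm.pow 2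
  unfold inducedGenerator
  exact h1.sub (Continuous.matrix_diagonal
    (Continuous.matrix_mulVec h1.matrix_transpose continuous_const))

/-- Permuting the columns of `U` relabels the generator but multiplies the determinant by the sign.
A phase `z` with `z ^ n` equal to the sign repairs this and cancels in `U* V_k U`. -/
theorem inducedGenerator_submatrix_mem (hn : n ≠ 0) {U : Matrix (Fin n) (Fin n) ℂ}
    (hU : U ∈ Matrix.specialUnitaryGroup (Fin n) ℂ) (π : Equiv.Perm (Fin n)) :
    ∃ U' ∈ Matrix.specialUnitaryGroup (Fin n) ℂ,
      inducedGenerator V U' = (inducedGenerator V U).submatrix π π := by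
  obtain ⟨hU1, hU2⟩ := Matrix.mem_specialUnitaryGroup_iff.mp hU
  obtain ⟨z, hz⟩ := IsAlgClosed.exists_pow_nat_eq (((Equiv.Perm.sign π : ℤˣ) : ℤ) : ℂ)
    (Nat.pos_of_ne_zero hn)
  have hz1 : ‖z‖ = 1 := by
    have : ‖z‖ ^ n = 1 := by
      rw [← norm_pow, hz]
      rcases Int.units_eq_one_or (Equiv.Perm.sign π) with h | h <;> simp [h]
    exact (pow_eq_one_iff_of_nonneg (norm_nonneg z) hn).mp this
  have hzz : z * star z = 1 := by
    rw [Complex.star_def, Complex.mul_conj, Complex.normSq_eq_norm_sq, hz1]; simp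
  set W := U.submatrix id π with hW
  have hsub : ∀ A : Matrix (Fin n) (Fin n) ℂ,
      (z • W).conjTranspose * A * (z • W) = (U.conjTranspose * A * U).submatrix π π := by
    intro A
    rw [Matrix.conjTranspose_smul, Matrix.smul_mul, Matrix.smul_mul, Matrix.mul_smul, smul_smul,
      mul_comm, hzz, one_smul]
    rfl
  refine ⟨z • W, Matrix.mem_specialUnitaryGroup_iff.mpr ⟨?_, ?_⟩, ?_⟩
  · rw [Matrix.mem_unitaryGroup_iff']
    have := hsub 1
    rw [mul_one, mul_one] at this
    rw [Matrix.star_eq_conjTranspose, this, ← Matrix.star_eq_conjTranspose,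
      Matrix.mem_unitaryGroup_iff'.mp hU1, Matrix.submatrix_one_equiv]
  · rw [Matrix.det_smul, Fintype.card_fin, hz, hW, Matrix.det_permute', hU2, mul_one]
    rcases Int.units_eq_one_or (Equiv.Perm.sign π) with h | h <;> simp [h]
  · have hJ : jumpMatrix V (z • W) = (jumpMatrix V U).submatrix π π := by
      ext i j
      simp only [jumpMatrix, Matrix.of_apply, hsub, Matrix.submatrix_apply]
    rw [inducedGenerator, inducedGenerator, hJ]
    ext i j
    simp only [Matrix.sub_apply, Matrix.submatrix_apply, Matrix.diagonal_apply, π.injective.eq_iff,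
      Matrix.mulVec, dotProduct, Matrix.transpose_apply, mul_one]
    rw [Equiv.sum_comp π (fun a => jumpMatrix V U a (π i))]

theorem jumpMatrix_nonneg (U : Matrix (Fin n) (Fin n) ℂ) (i j : Fin n) :
    0 ≤ jumpMatrix V U i j := by
  simp only [jumpMatrix, Matrix.of_apply]
  exact Finset.sum_nonneg fun _ _ => sq_nonneg _

theorem exists_isGeneratorFamily (hn : n ≠ 0) : ∃ K, IsGeneratorFamily (generatorHull V) K := by
  have hcpt : IsCompact (generatorHull V) := isCompact_convexHull_of_isCompact
    ((isCompact_specialUnitaryGroup n).image (continuous_inducedGenerator V))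
  obtain ⟨K, hK⟩ := hcpt.exists_bound_of_continuousOn
    (f := fun L : Matrix (Fin n) (Fin n) ℝ => ∑ i, ∑ j, |L i j|)
    (by
      refine Continuous.continuousOn (continuous_finsetSum _ fun i _ => continuous_finsetSum _
        fun j _ => ?_)
      exact (continuous_id.matrix_elem i j).abs)
  refine ⟨max K 1, convex_convexHull ℝ _, hcpt, ?_, ?_, ?_, ?_, by positivity⟩
  · intro L hL π
    have h := LinearMap.image_convexHull
      (Matrix.reindexLinearEquiv ℝ ℝ π.symm π.symm :
        Matrix (Fin n) (Fin n) ℝ ≃ₗ[ℝ] Matrix (Fin n) (Fin n) ℝ).toLinearMap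
      (inducedGenerator V '' (Matrix.specialUnitaryGroup (Fin n) ℂ : Set _))
    have h1 : L.submatrix π π ∈ convexHull ℝ _ := h.subset ⟨L, hL, rfl⟩
    refine convexHull_mono ?_ h1
    rintro _ ⟨_, ⟨U, hU, rfl⟩, rfl⟩
    obtain ⟨U', hU', h'⟩ := inducedGenerator_submatrix_mem V hn hU π
    exact ⟨U', hU', h'⟩
  · intro L hL i j hij
    have hconv : Convex ℝ {L : Matrix (Fin n) (Fin n) ℝ | 0 ≤ L i j} := by
      intro A hA B hB a b ha hb _
      exact add_nonneg (mul_nonneg ha hA) (mul_nonneg hb hB)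
    refine convexHull_min ?_ hconv hL
    rintro _ ⟨U, -, rfl⟩
    simp only [mem_ofPred_eq, inducedGenerator, Matrix.sub_apply, Matrix.diagonal_apply_ne _ hij,
      sub_zero]
    exact jumpMatrix_nonneg V U i j
  · intro L hL j
    have hconv : Convex ℝ {L : Matrix (Fin n) (Fin n) ℝ | ∑ i, L i j = 0} := by
      intro A hA B hB a b _ _ _
      simp only [mem_ofPred_eq] at hA hB ⊢
      simp only [Matrix.add_apply, Matrix.smul_apply, smul_eq_mul, Finset.sum_add_distrib,
        ← Finset.mul_sum, hA, hB, mul_zero, add_zero]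
    refine convexHull_min ?_ hconv hL
    rintro _ ⟨U, -, rfl⟩
    simp [inducedGenerator, Matrix.diagonal_apply, Matrix.mulVec, dotProduct]
  · intro L hL i j
    refine le_trans ?_ (le_max_left K 1)
    refine le_trans ?_ (hK L hL)
    refine le_trans ?_ (le_abs_self _)
    exact (Finset.single_le_sum (f := fun j => |L i j|) (fun _ _ => abs_nonneg _)
      (Finset.mem_univ j)).trans (Finset.single_le_sum (f := fun i => ∑ j, |L i j|)
      (fun _ _ => Finset.sum_nonneg fun _ _ => abs_nonneg _) (Finset.mem_univ i))

end Generators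

/-! ### From the differential inclusion to Euler steps. -/

theorem AbsolutelyContinuousOnInterval.eval {n : ℕ} {x : ℝ → Fin n → ℝ} {a b : ℝ}
    (hx : AbsolutelyContinuousOnInterval x a b) (i : Fin n) :
    AbsolutelyContinuousOnInterval (fun t => x t i) a b := by
  rw [absolutelyContinuousOnInterval_iff] at hx ⊢
  intro ε hε
  obtain ⟨δ, hδ, h⟩ := hx ε hε
  exact ⟨δ, hδ, fun E hE hE' => (Finset.sum_le_sum fun j _ =>
    dist_le_pi_dist (x (E.2 j).1) (x (E.2 j).2) i).trans_lt (h E hE hE')⟩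

/-- The mean slope of an absolutely continuous curve lies in every closed convex set containing
almost all of its derivatives. -/
theorem exists_mem_eq_add_smul_of_ae_hasDerivAt {n : ℕ} {x : ℝ → Fin n → ℝ} {a b : ℝ} (hab : a < b)
    (hx : AbsolutelyContinuousOnInterval x a b) {S : Set (Fin n → ℝ)} (hS : Convex ℝ S)
    (hSc : IsClosed S)
    (hd : ∀ᵐ t ∂(volume.restrict (Ioc a b)), ∃ v ∈ S, HasDerivAt x v t) :
    ∃ v ∈ S, x b = x a + (b - a) • v := by
  let g : ℝ → Fin n → ℝ := fun t i => deriv (fun s => x s i) t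
  have hgS : ∀ᵐ t ∂(volume.restrict (Ioc a b)), g t ∈ S := by
    filter_upwards [hd] with t ⟨v, hv, hvt⟩
    have : g t = v := funext fun i => ((hasDerivAt_pi.mp hvt) i).deriv
    rwa [this]
  have hint : ∀ i, IntegrableOn (fun t => g t i) (Ioc a b) := fun i =>
    (intervalIntegrable_iff_integrableOn_Ioc_of_le hab.le).mp
      (hx.eval i).intervalIntegrable_deriv
  have hgi : IntegrableOn g (Ioc a b) := Integrable.of_eval hint
  have hvol : volume (Ioc a b) = ENNReal.ofReal (b - a) := Real.volume_Ioc
  refine ⟨_, hS.set_average_mem hSc ?_ ?_ hgS hgi, ?_⟩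
  · rw [hvol]; simpa using hab
  · rw [hvol]; exact ENNReal.ofReal_ne_top
  · rw [setAverage_eq, measureReal_def, hvol, ENNReal.toReal_ofReal (by linarith), smul_smul,
      mul_inv_cancel₀ (by linarith), one_smul]
    funext i
    rw [Pi.add_apply, eval_integral hint, ← intervalIntegral.integral_of_le hab.le]
    have := (hx.eval i).integral_deriv_eq_sub
    simp only [g]
    linarith

namespace IsGeneratorFamily

variable {n : ℕ} {Q : Set (Matrix (Fin n) (Fin n) ℝ)} {K : ℝ}

theorem abs_sub_le_of_solution (hQ : IsGeneratorFamily Q K) {x : ℝ → Fin n → ℝ}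
    (hxS : ∀ t, 0 ≤ t → x t ∈ stdSimplex ℝ (Fin n))
    (hxA : ∀ T, 0 ≤ T → AbsolutelyContinuousOnInterval x 0 T)
    (hxd : ∀ᵐ t ∂(volume.restrict (Ici (0 : ℝ))), ∃ L ∈ Q, HasDerivAt x (L.mulVec (x t)) t)
    {s t : ℝ} (hs : 0 ≤ s) (hst : s ≤ t) (i : Fin n) : |x t i - x s i| ≤ K * (t - s) := by
  rcases hst.eq_or_lt with rfl | hlt
  · simp
  have hsub : Ioc s t ⊆ Ici 0 := fun a ha => hs.trans ha.1.le
  obtain ⟨v, hv, hvt⟩ := exists_mem_eq_add_smul_of_ae_hasDerivAt hlt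
    ((hxA t (hs.trans hst)).mono (by
      rw [uIcc_of_le hst, uIcc_of_le (hs.trans hst)]; exact Icc_subset_Icc_left hs))
    (convex_closedBall (0 : Fin n → ℝ) K) Metric.isClosed_closedBall (by
      filter_upwards [ae_restrict_of_ae_restrict_of_subset hsub hxd,
        ae_restrict_mem measurableSet_Ioc] with a ⟨L, hL, hLa⟩ ha
      refine ⟨_, ?_, hLa⟩
      rw [mem_closedBall_zero_iff, pi_norm_le_iff_of_nonneg hQ.pos.le]
      exact abs_mulVec_le_of_mem_stdSimplex (hQ.abs_le L hL) (hxS a (hsub ha)))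
  rw [mem_closedBall_zero_iff, pi_norm_le_iff_of_nonneg hQ.pos.le] at hv
  rw [hvt, Pi.add_apply, add_sub_cancel_left, Pi.smul_apply, smul_eq_mul, abs_mul,
    abs_of_pos (sub_pos.mpr hlt), mul_comm]
  exact mul_le_mul_of_nonneg_right (hv i) (by linarith)

open scoped Pointwise in
/-- Solutions of the differential inclusion follow Euler steps up to second order. -/
theorem exists_euler_of_solution (hQ : IsGeneratorFamily Q K) {x : ℝ → Fin n → ℝ}
    (hxS : ∀ t, 0 ≤ t → x t ∈ stdSimplex ℝ (Fin n))
    (hxA : ∀ T, 0 ≤ T → AbsolutelyContinuousOnInterval x 0 T)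
    (hxd : ∀ᵐ t ∂(volume.restrict (Ici (0 : ℝ))), ∃ L ∈ Q, HasDerivAt x (L.mulVec (x t)) t)
    {s t : ℝ} (hs : 0 ≤ s) (hst : s < t) :
    ∃ L ∈ Q, ∀ i, |x t i - (x s + (t - s) • L.mulVec (x s)) i| ≤ n * K ^ 2 * (t - s) ^ 2 := by
  have hsub : Ioc s t ⊆ Ici 0 := fun a ha => hs.trans ha.1.le
  set δ := n * K * (K * (t - s)) with hδ
  have hδ0 : 0 ≤ δ := by
    have := hQ.pos; have := sub_pos.mpr hst; positivity
  have hlin : IsLinearMap ℝ (fun L : Matrix (Fin n) (Fin n) ℝ => L.mulVec (x s)) :=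
    ⟨fun A B => Matrix.add_mulVec A B _, fun c A => Matrix.smul_mulVec c A _⟩
  have hcQ : IsCompact ((fun L : Matrix (Fin n) (Fin n) ℝ => L.mulVec (x s)) '' Q) :=
    hQ.isCompact.image (by fun_prop)
  obtain ⟨v, hv, hvt⟩ := exists_mem_eq_add_smul_of_ae_hasDerivAt hst
    ((hxA t (hs.trans hst.le)).mono (by
      rw [uIcc_of_le hst.le, uIcc_of_le (hs.trans hst.le)]; exact Icc_subset_Icc_left hs))
    -- On `(s, t]` the state stays within `K * (t - s)` of `x s`, so freezing it at `x s` changes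
    -- the velocity by at most `δ`.
    (S := (fun L : Matrix (Fin n) (Fin n) ℝ => L.mulVec (x s)) '' Q +
      Metric.closedBall (0 : Fin n → ℝ) δ)
    ((hQ.convex.is_linear_image hlin).add (convex_closedBall _ _))
    (hcQ.add (isCompact_closedBall _ _)).isClosed (by
      filter_upwards [ae_restrict_of_ae_restrict_of_subset hsub hxd,
        ae_restrict_mem measurableSet_Ioc] with a ⟨L, hL, hLa⟩ ha
      refine ⟨_, ?_, hLa⟩
      refine ⟨_, ⟨L, hL, rfl⟩, L.mulVec (x a - x s), ?_, ?_⟩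
      · rw [mem_closedBall_zero_iff, pi_norm_le_iff_of_nonneg hδ0]
        refine abs_mulVec_le_of_forall_le (hQ.abs_le L hL) hQ.pos.le fun i => ?_
        refine (hQ.abs_sub_le_of_solution hxS hxA hxd hs ha.1.le i).trans ?_
        exact mul_le_mul_of_nonneg_left (by linarith [ha.2]) hQ.pos.le
      · simp only [Matrix.mulVec_sub]
        abel)
  obtain ⟨_, ⟨L, hL, rfl⟩, e, he, rfl⟩ := hv
  refine ⟨L, hL, fun i => ?_⟩
  rw [mem_closedBall_zero_iff, pi_norm_le_iff_of_nonneg hδ0] at he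
  have : x t i - (x s + (t - s) • L.mulVec (x s)) i = (t - s) * e i := by
    rw [hvt]
    simp only [Pi.add_apply, Pi.smul_apply, smul_eq_mul]
    ring
  rw [this, abs_mul, abs_of_pos (sub_pos.mpr hst)]
  calc (t - s) * |e i| ≤ (t - s) * δ := mul_le_mul_of_nonneg_left (he i) (by linarith)
    _ = _ := by rw [hδ]; ring

end IsGeneratorFamily

/-! ### Euler polygons and their limit. -/

/-- A fixed nonprincipal ultrafilter gives limits at all times, and of all chosen generators,
simultaneously, with no extraction of subsequences. -/
theorem IsCompact.exists_tendsto_hyperfilter {X : Type*} [TopologicalSpace X] {s : Set X}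
    (hs : IsCompact s) {u : ℕ → X} (hu : ∀ N, u N ∈ s) :
    ∃ a ∈ s, Filter.Tendsto u (Filter.hyperfilter ℕ) (nhds a) :=
  hs.ultrafilter_le_nhds' ((Filter.hyperfilter ℕ).map u)
    (Filter.mem_map.mpr (Filter.univ_mem' hu))

theorem exists_seq_of_step {α : Type*} {P : ℕ → α → Prop} {R : α → α → Prop} {a : α} (h0 : P 0 a)
    (hs : ∀ j x, P j x → ∃ x', P (j + 1) x' ∧ R x x') :
    ∃ f : ℕ → α, f 0 = a ∧ ∀ j, P j (f j) ∧ R (f j) (f (j + 1)) := by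
  choose! F hF using hs
  let f : ℕ → α := fun j => Nat.rec a (fun i x => F i x) j
  have hf : ∀ j, P j (f j) := fun j => by
    induction j with
    | zero => exact h0
    | succ j ih => exact (hF j _ ih).1
  exact ⟨f, rfl, fun j => ⟨hf j, (hF j _ (hf j)).2⟩⟩

theorem tendsto_floor_div_mul {h : ℕ → ℝ} (hpos : ∀ N, 0 < h N)
    (hlim : Filter.Tendsto h Filter.atTop (nhds 0)) (t : ℝ) :
    Filter.Tendsto (fun N => (⌊t / h N⌋₊ : ℝ) * h N) Filter.atTop (nhds (max t 0)) := by
  rw [← tendsto_sub_nhds_zero_iff]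
  refine squeeze_zero_norm (fun N => ?_) hlim
  have hN := hpos N
  rw [Real.norm_eq_abs]
  rcases le_total t 0 with ht | ht
  · rw [Nat.floor_of_nonpos (div_nonpos_of_nonpos_of_nonneg ht hN.le), max_eq_right ht]
    simpa using hN.le
  · have h1 := Nat.floor_le (div_nonneg ht hN.le)
    have h2 := Nat.lt_floor_add_one (t / h N)
    rw [le_div_iff₀ hN] at h1
    rw [div_lt_iff₀ hN] at h2
    rw [max_eq_left ht, abs_le]
    constructor <;> linarith

namespace IsGeneratorFamily

variable {n : ℕ} {Q : Set (Matrix (Fin n) (Fin n) ℝ)} {K : ℝ}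

/-- An Euler polygon which approximately majorizes the given curve at all grid points. -/
theorem exists_euler_polygon (hQ : IsGeneratorFamily Q K) {mu : ℝ → Fin n → ℝ}
    (hmu : ∀ s t, 0 ≤ s → s < t → ∃ L ∈ Q, ∀ i,
      |mu t i - (mu s + (t - s) • L.mulVec (mu s)) i| ≤ n * K ^ 2 * (t - s) ^ 2)
    {x₀ : Fin n → ℝ} (hx₀ : x₀ ∈ stdSimplex ℝ (Fin n))
    (hmaj : ∀ k ≤ n, topSum k (mu 0) ≤ topSum k x₀) {h : ℝ} (hh : 0 < h) (hhK : h * K ≤ 1) :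
    ∃ x : ℕ → Fin n → ℝ, x 0 = x₀ ∧ (∀ j, x j ∈ stdSimplex ℝ (Fin n)) ∧
      (∀ j : ℕ, ∀ k ≤ n,
        topSum k (mu (j * h)) ≤ topSum k (x j) + j * (3 * n ^ 2 * K ^ 2 * h ^ 2)) ∧
      ∀ j, ∃ L ∈ Q, x (j + 1) = x j + h • L.mulVec (x j) := by
  have hKp := hQ.pos
  obtain ⟨x, hx0, hx⟩ := exists_seq_of_step (a := x₀)
    (P := fun j x => x ∈ stdSimplex ℝ (Fin n) ∧ ∀ k ≤ n,
      topSum k (mu (j * h)) ≤ topSum k x + j * (3 * n ^ 2 * K ^ 2 * h ^ 2))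
    (R := fun x y => ∃ L ∈ Q, y = x + h • L.mulVec x)
    ⟨hx₀, by simpa using hmaj⟩ (by
      rintro j x ⟨hxS, hxm⟩
      obtain ⟨L, hL, hLmu⟩ := hmu (j * h) ((j + 1 : ℕ) * h) (by positivity) (by push_cast; linarith)
      rw [show ((j + 1 : ℕ) : ℝ) * h - j * h = h by push_cast; ring] at hLmu
      obtain ⟨L', hL', hstep⟩ := hQ.exists_step hL hh.le hhK hxS (by positivity) hxm
      refine ⟨_, ⟨hQ.euler_mem_stdSimplex hL' hh.le hhK hxS, fun k hk => ?_⟩, L', hL', rfl⟩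
      -- This error contributes `n ^ 2 * K ^ 2 * h ^ 2`; `exists_step` contributes twice as much,
      -- hence the factor 3.
      have h1 := topSum_le_add k (δ := n * K ^ 2 * h ^ 2) (by positivity) fun i => by
        have := (_root_.abs_le.mp (hLmu i)).2
        exact sub_le_iff_le_add'.mp this
      have h2 := hstep k hk
      push_cast at h1 ⊢
      linarith)
  exact ⟨x, hx0, fun j => (hx j).1.1, fun j => (hx j).1.2, fun j => (hx j).2⟩

theorem abs_euler_sub_le (hQ : IsGeneratorFamily Q K) {x : ℕ → Fin n → ℝ}
    (hx : ∀ j, x j ∈ stdSimplex ℝ (Fin n)) {h : ℝ} (hh : 0 ≤ h)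
    (hstep : ∀ j, ∃ L ∈ Q, x (j + 1) = x j + h • L.mulVec (x j)) (j p : ℕ) (i : Fin n) :
    |x (j + p) i - x j i| ≤ K * (p * h) := by
  induction p with
  | zero => simp
  | succ p ih =>
    obtain ⟨L, hL, hLx⟩ := hstep (j + p)
    have h1 := abs_mulVec_le_of_mem_stdSimplex (hQ.abs_le L hL) (hx (j + p)) i
    have h2 : |h * L.mulVec (x (j + p)) i| ≤ h * K := by
      rw [abs_mul, abs_of_nonneg hh]; exact mul_le_mul_of_nonneg_left h1 hh
    rw [← add_assoc, hLx, Pi.add_apply, Pi.smul_apply, smul_eq_mul]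
    push_cast
    rw [_root_.abs_le] at ih h2 ⊢
    constructor <;> linarith [ih.1, ih.2, h2.1, h2.2]

/-- The generator is the average of the `p` generators used. Applying each at the initial state
costs at most `n * K ^ 2 * p * h ^ 2` per step, since the state drifts by at most `K * p * h`. -/
theorem exists_euler_chord (hQ : IsGeneratorFamily Q K) {x : ℕ → Fin n → ℝ}
    (hx : ∀ j, x j ∈ stdSimplex ℝ (Fin n)) {h : ℝ} (hh : 0 ≤ h)
    (hstep : ∀ j, ∃ L ∈ Q, x (j + 1) = x j + h • L.mulVec (x j)) (j p : ℕ) :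
    ∃ L ∈ Q, ∀ i,
      |x (j + p) i - (x j + (p * h) • L.mulVec (x j)) i| ≤ n * K ^ 2 * (p * h) ^ 2 := by
  induction p with
  | zero =>
    obtain ⟨L, hL, -⟩ := hstep j
    exact ⟨L, hL, fun i => by simp⟩
  | succ p ih =>
    obtain ⟨A, hA, hAx⟩ := ih
    obtain ⟨B, hB, hBx⟩ := hstep (j + p)
    have hp : (0 : ℝ) < p + 1 := by positivity
    refine ⟨(p / (p + 1) : ℝ) • A + (1 / (p + 1) : ℝ) • B,
      hQ.convex hA hB (by positivity) (by positivity) (by field_simp), fun i => ?_⟩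
    have h1 := hAx i
    have h2 : |h * B.mulVec (x (j + p) - x j) i| ≤ h * (n * K * (K * (p * h))) := by
      rw [abs_mul, abs_of_nonneg hh]
      exact mul_le_mul_of_nonneg_left (abs_mulVec_le_of_forall_le (hQ.abs_le B hB) hQ.pos.le
        (hQ.abs_euler_sub_le hx hh hstep j p) i) hh
    have e : x (j + (p + 1)) i - (x j + (((p + 1 : ℕ) : ℝ) * h) •
        ((p / (p + 1) : ℝ) • A + (1 / (p + 1) : ℝ) • B).mulVec (x j)) i =
        (x (j + p) i - (x j + (p * h) • A.mulVec (x j)) i) +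
          h * B.mulVec (x (j + p) - x j) i := by
      rw [← add_assoc, hBx, Matrix.add_mulVec, Matrix.smul_mulVec, Matrix.smul_mulVec,
        Matrix.mulVec_sub]
      simp only [Pi.add_apply, Pi.smul_apply, smul_eq_mul, Pi.sub_apply]
      push_cast
      field_simp
      ring
    rw [e]
    refine (abs_add_le _ _).trans ((add_le_add h1 h2).trans ?_)
    push_cast
    have : (0 : ℝ) ≤ n * K ^ 2 * h ^ 2 * (p + 1) := by positivity
    linarith

/-- A curve with second-order accurate chords has its derivatives in the right-hand side of the
differential inclusion. -/
theorem exists_mulVec_eq_of_hasDerivAt (hQ : IsGeneratorFamily Q K) {x : ℝ → Fin n → ℝ} {s C : ℝ}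
    (hx : ∀ t, s ≤ t → ∃ L ∈ Q, ∀ i,
      |x t i - (x s + (t - s) • L.mulVec (x s)) i| ≤ C * (t - s) ^ 2)
    {v : Fin n → ℝ} (hv : HasDerivAt x v s) : ∃ L ∈ Q, v = L.mulVec (x s) := by
  let u : ℕ → ℝ := fun m => 1 / ((m : ℝ) + 1)
  have hu : ∀ m, 0 < u m := fun m => Nat.one_div_pos_of_nat
  have hulim : Filter.Tendsto u Filter.atTop (nhds 0) := tendsto_one_div_add_atTop_nhds_zero_nat
  choose L hLQ hL using fun m => hx (s + u m) (by linarith [hu m])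
  obtain ⟨A, hA, hLA⟩ := hQ.isCompact.exists_tendsto_hyperfilter hLQ
  have hslope : Filter.Tendsto (fun m => (u m)⁻¹ • (x (s + u m) - x s)) Filter.atTop (nhds v) :=
    (hasDerivAt_iff_tendsto_slope_zero.mp hv).comp
      (tendsto_nhdsWithin_iff.mpr ⟨hulim, Filter.Eventually.of_forall fun m => (hu m).ne'⟩)
  refine ⟨A, hA, funext fun i => ?_⟩
  have hmul : Continuous fun L : Matrix (Fin n) (Fin n) ℝ => L.mulVec (x s) i := by fun_prop
  have t1 : Filter.Tendsto (fun m => |((u m)⁻¹ • (x (s + u m) - x s)) i - (L m).mulVec (x s) i|)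
      (Filter.hyperfilter ℕ) (nhds |v i - A.mulVec (x s) i|) :=
    ((((continuous_apply i).tendsto v).comp (hslope.mono_left Nat.hyperfilter_le_atTop)).sub
      ((hmul.tendsto A).comp hLA)).abs
  have t2 : Filter.Tendsto (fun m => C * u m) (Filter.hyperfilter ℕ) (nhds (C * 0)) :=
    (hulim.mono_left Nat.hyperfilter_le_atTop).const_mul C
  have hle := le_of_tendsto_of_tendsto' t1 t2 fun m => by
    have h1 := hL m i
    have hm := hu m
    rw [add_sub_cancel_left] at h1
    have e : ((u m)⁻¹ • (x (s + u m) - x s)) i - (L m).mulVec (x s) i =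
        (u m)⁻¹ * (x (s + u m) i - (x s + u m • (L m).mulVec (x s)) i) := by
      simp only [Pi.smul_apply, Pi.sub_apply, Pi.add_apply, smul_eq_mul]
      field_simp
      ring
    rw [e, abs_mul, abs_of_pos (inv_pos.mpr hm)]
    calc (u m)⁻¹ * _ ≤ (u m)⁻¹ * (C * u m ^ 2) :=
          mul_le_mul_of_nonneg_left h1 (inv_pos.mpr hm).le
      _ = C * u m := by field_simp
  rw [mul_zero] at hle
  exact sub_eq_zero.mp (abs_nonpos_iff.mp hle)

/-- Majorization at time zero propagates along a suitable solution of the inclusion. -/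
theorem exists_majorizing_solution (hQ : IsGeneratorFamily Q K) {mu : ℝ → Fin n → ℝ}
    (hmuS : ∀ t, 0 ≤ t → mu t ∈ stdSimplex ℝ (Fin n))
    (hmuA : ∀ T, 0 ≤ T → AbsolutelyContinuousOnInterval mu 0 T)
    (hmud : ∀ᵐ t ∂(volume.restrict (Ici (0 : ℝ))), ∃ L ∈ Q, HasDerivAt mu (L.mulVec (mu t)) t)
    {x₀ : Fin n → ℝ} (hx₀ : x₀ ∈ stdSimplex ℝ (Fin n))
    (hmaj : ∀ k ≤ n, topSum k (mu 0) ≤ topSum k x₀) :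
    ∃ x : ℝ → Fin n → ℝ, x 0 = x₀ ∧ (∀ t, x t ∈ stdSimplex ℝ (Fin n)) ∧
      LipschitzWith K.toNNReal x ∧
      (∀ᵐ t ∂(volume.restrict (Ici (0 : ℝ))), ∃ L ∈ Q, HasDerivAt x (L.mulVec (x t)) t) ∧
      ∀ t, 0 ≤ t → ∀ k ≤ n, topSum k (mu t) ≤ topSum k (x t) := by
  have hK := hQ.pos
  let h : ℕ → ℝ := fun N => K⁻¹ * (1 / ((N : ℝ) + 1))
  have hpos : ∀ N, 0 < h N := fun N => by positivity
  have hlim : Filter.Tendsto h Filter.atTop (nhds 0) := by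
    simpa [h] using (tendsto_one_div_add_atTop_nhds_zero_nat (𝕜 := ℝ)).const_mul K⁻¹
  have hhK : ∀ N, h N * K ≤ 1 := fun N => by
    have : h N * K = 1 / ((N : ℝ) + 1) := by simp only [h]; field_simp
    rw [this, div_le_one (by positivity)]
    linarith [Nat.cast_nonneg (α := ℝ) N]
  choose y hy0 hyS hym hystep using fun N => hQ.exists_euler_polygon
    (fun s t hs hst => hQ.exists_euler_of_solution hmuS hmuA hmud hs hst) hx₀ hmaj (hpos N) (hhK N)
  -- The polygons enter as step functions. For negative `t` the floor is 0, so `x` is constant there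
  -- and the Lipschitz bound holds on the whole line.
  choose x hxS hxlim using fun t : ℝ => (isCompact_stdSimplex ℝ (Fin n)).exists_tendsto_hyperfilter
    (u := fun N => y N ⌊t / h N⌋₊) fun N => hyS N _
  have hxi : ∀ t i, Filter.Tendsto (fun N => y N ⌊t / h N⌋₊ i) (Filter.hyperfilter ℕ)
      (nhds (x t i)) := fun t i => ((continuous_apply i).tendsto _).comp (hxlim t)
  have hfl : ∀ t, Filter.Tendsto (fun N => (⌊t / h N⌋₊ : ℝ) * h N) (Filter.hyperfilter ℕ)
      (nhds (max t 0)) := fun t =>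
    (tendsto_floor_div_mul hpos hlim t).mono_left Nat.hyperfilter_le_atTop
  have hfloor : ∀ s t N, s ≤ t → ∃ p : ℕ, ⌊t / h N⌋₊ = ⌊s / h N⌋₊ + p ∧
      (p : ℝ) * h N = ⌊t / h N⌋₊ * h N - ⌊s / h N⌋₊ * h N := fun s t N hst => by
    obtain ⟨p, hp⟩ := Nat.exists_eq_add_of_le
      (Nat.floor_le_floor (div_le_div_of_nonneg_right hst (hpos N).le))
    exact ⟨p, hp, by rw [hp]; push_cast; ring⟩
  have hlip : ∀ s t, s ≤ t → ∀ i, |x t i - x s i| ≤ K * (t - s) := fun s t hst i => by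
    have t1 := ((hxi t i).sub (hxi s i)).abs
    have t2 := ((hfl t).sub (hfl s)).const_mul K
    refine (le_of_tendsto_of_tendsto' t1 t2 fun N => ?_).trans ?_
    · obtain ⟨p, hp, hp'⟩ := hfloor s t N hst
      rw [← hp', hp]
      exact hQ.abs_euler_sub_le (hyS N) (hpos N).le (hystep N) _ _ _
    · refine mul_le_mul_of_nonneg_left ?_ hK.le
      rcases le_total t 0 with ht | ht <;> rcases le_total s 0 with hs | hs <;>
        simp only [max_eq_left, max_eq_right, ht, hs] <;> linarith
  have hchord : ∀ s, 0 ≤ s → ∀ t, s ≤ t → ∃ L ∈ Q, ∀ i,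
      |x t i - (x s + (t - s) • L.mulVec (x s)) i| ≤ n * K ^ 2 * (t - s) ^ 2 := by
    intro s hs t hst
    have key : ∀ N, ∃ L ∈ Q, ∀ i, |y N ⌊t / h N⌋₊ i - (y N ⌊s / h N⌋₊ +
        (⌊t / h N⌋₊ * h N - ⌊s / h N⌋₊ * h N) • L.mulVec (y N ⌊s / h N⌋₊)) i| ≤
        n * K ^ 2 * (⌊t / h N⌋₊ * h N - ⌊s / h N⌋₊ * h N) ^ 2 := fun N => by
      obtain ⟨p, hp, hp'⟩ := hfloor s t N hst
      rw [← hp', hp]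
      exact hQ.exists_euler_chord (hyS N) (hpos N).le (hystep N) _ _
    choose L hLQ hL using key
    obtain ⟨A, hA, hLA⟩ := hQ.isCompact.exists_tendsto_hyperfilter hLQ
    refine ⟨A, hA, fun i => ?_⟩
    have hts := (hfl t).sub (hfl s)
    rw [max_eq_left hs, max_eq_left (hs.trans hst)] at hts
    have hmul : Continuous fun q : Matrix (Fin n) (Fin n) ℝ × (Fin n → ℝ) => q.1.mulVec q.2 i := by
      fun_prop
    have t1 := ((hxi t i).sub ((hxi s i).add (hts.mul
      ((hmul.tendsto (A, x s)).comp (hLA.prodMk_nhds (hxlim s)))))).abs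
    have t2 := (hts.pow 2).const_mul ((n : ℝ) * K ^ 2)
    exact le_of_tendsto_of_tendsto' t1 t2 fun N => hL N i
  have hLip : LipschitzWith K.toNNReal x := by
    refine LipschitzWith.of_dist_le_mul fun a b => ?_
    rw [Real.coe_toNNReal _ hK.le]
    refine (dist_pi_le_iff (mul_nonneg hK.le dist_nonneg)).mpr fun i => ?_
    rw [Real.dist_eq, Real.dist_eq]
    rcases le_total a b with hab | hab
    · rw [abs_sub_comm, abs_sub_comm a, abs_of_nonneg (sub_nonneg.mpr hab)]
      exact hlip a b hab i
    · rw [abs_of_nonneg (sub_nonneg.mpr hab)]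
      exact hlip b a hab i
  refine ⟨x, ?_, hxS, hLip, ?_, ?_⟩
  · refine tendsto_nhds_unique (hxlim 0) ?_
    simp only [zero_div, Nat.floor_zero, hy0]
    exact tendsto_const_nhds
  · filter_upwards [ae_restrict_of_ae hLip.ae_differentiableAt_real,
      ae_restrict_mem measurableSet_Ici] with t ht ht0
    obtain ⟨L, hL, hLt⟩ := hQ.exists_mulVec_eq_of_hasDerivAt (hchord t ht0) ht.hasDerivAt
    exact ⟨L, hL, hLt ▸ ht.hasDerivAt⟩
  · intro t ht k hk
    have hflt := hfl t
    rw [max_eq_left ht] at hflt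
    -- Nothing is known about `mu` at negative times; one-sided continuity suffices, as the grid
    -- points lie in `[0, t]`.
    have hmuc : ContinuousWithinAt mu (Icc 0 (t + 1)) t := by
      have := (hmuA (t + 1) (by linarith)).continuousOn
      rw [uIcc_of_le (by linarith)] at this
      exact this t ⟨ht, by linarith⟩
    have hin : Filter.Tendsto (fun N => (⌊t / h N⌋₊ : ℝ) * h N) (Filter.hyperfilter ℕ)
        (nhdsWithin t (Icc 0 (t + 1))) :=
      tendsto_nhdsWithin_iff.mpr ⟨hflt, Filter.Eventually.of_forall fun N =>
        ⟨mul_nonneg (Nat.cast_nonneg _) (hpos N).le, by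
          have := Nat.floor_le (div_nonneg ht (hpos N).le)
          rw [le_div_iff₀ (hpos N)] at this
          linarith⟩⟩
    have t1 := ((continuous_topSum k).tendsto _).comp (hmuc.tendsto.comp hin)
    -- The accumulated error is `(j * h) * h * (3 * n ^ 2 * K ^ 2)` with `j * h → t`, so it
    -- vanishes.
    have t2 := (((continuous_topSum k).tendsto _).comp (hxlim t)).add
      ((hflt.mul (hlim.mono_left Nat.hyperfilter_le_atTop)).mul_const (3 * (n : ℝ) ^ 2 * K ^ 2))
    rw [mul_zero, zero_mul, add_zero] at t2
    refine le_of_tendsto_of_tendsto' t1 t2 fun N => ?_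
    refine (hym N _ k hk).trans_eq ?_
    simp only [Function.comp]
    ring

end IsGeneratorFamily

theorem mainTheorem2 {n r : ℕ} (V : Fin r → Matrix (Fin n) (Fin n) ℂ)
    (mu : ℝ → Fin n → ℝ) (hmu : IsRelaxedSolution V mu)
    (lam₀ : Fin n → ℝ) (hlam₀ : lam₀ ∈ stdSimplex ℝ (Fin n))
    (hmaj : Majorizes lam₀ (mu 0)) :
    ∃ lam : ℝ → Fin n → ℝ, IsRelaxedSolution V lam ∧ lam 0 = lam₀ ∧
      ∀ t : ℝ, 0 ≤ t → Majorizes (lam t) (mu t) := by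
  have hn : n ≠ 0 := by
    rintro rfl
    simpa using hlam₀.2
  obtain ⟨K, hQ⟩ := exists_isGeneratorFamily V hn
  obtain ⟨lam, h0, hS, hLip, hd, hm⟩ := hQ.exists_majorizing_solution hmu.mem_simplex
    hmu.absolutelyContinuous (by
      filter_upwards [hmu.hasDerivAt_ae] with t ⟨v, hv, hvt⟩
      rw [convexHull_achievableDerivatives] at hv
      obtain ⟨L, hL, rfl⟩ := hv
      exact ⟨L, hL, hvt⟩) hlam₀ (fun k hk => by
      rcases Nat.eq_zero_or_pos k with rfl | hk0
      · simp [topSum]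
      · exact hmaj k hk0 hk)
  refine ⟨lam, ⟨fun t _ => hS t, fun T _ => hLip.lipschitzOnWith.absolutelyContinuousOnInterval,
    ?_⟩, h0, fun t ht k _ hk => hm t ht k hk⟩
  filter_upwards [hd] with t ⟨L, hL, hLt⟩
  refine ⟨_, ?_, hLt⟩
  rw [convexHull_achievableDerivatives]
  exact ⟨L, hL, rfl⟩
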